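/- Let $(M,g)$ be a finite-dimensional Lorentzian manifold of signature $(+,\dots,+,-)$ with Levi-Civita derivative $\nabla$, and let $\Sigma$ be a $2$-dimensional immersed timelike submanifold of $M$ (i.e. the induced metric on $\Sigma$ is Lorentzian). Let $k\in\{1,2,\dots,\infty\}$; manifolds, the immersion and curves are of class $C^{k+1}$, the metric and vector fields of class $C^k$. Let $n$ and $\tau$ be vector fields on $\Sigma$ (tangent to $\Sigma$) with $g(n,n)=-1$, $g(n,\tau)=0$, $g(\tau,\tau)=1$, and put $l^{\pm}=n\pm\tau$. A particle worldline in $\Sigma$ is a curve $\lambda$ in $\Sigma$, defined on an open interval, whose tangent field $u=\dot\lambda$ satisfies $g(u,u)=-1$ and can be written as $$u=\gamma\,(n+v\,\tau),\qquad \gamma=\frac1{\sqrt{1-v^2}},\qquad -1<v<1$$ (i.e. $u$ lies in the same half of the light cone as $n$); this defines its spatial velocity $v$. Its Coriolis and centrifugal accelerations are $$a_{\mathrm{Cor}}=-\gamma^2v\big(\nabla_n\tau+\nabla_\tau n+g(\nabla_n\tau,n)\,n-g(\nabla_\tau n,\tau)\,\tau\big),$$ $$a_{\mathrm{cen}}=-\gamma^2v^2\big(\nabla_\tau\tau+\nabla_n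 n+g(\nabla_\tau\tau,n)\,n-g(\nabla_n n,\tau)\,\tau\big).$$ A regular curve $\mu$ is called a geodesic if $\nabla_{\dot\mu}\dot\mu$ is everywhere a multiple of $\dot\mu$ (the parametrization need not be affine). Then: 1. $a_{\mathrm{cen}}=-v\,a_{\mathrm{Cor}}$ holds along all particle worldlines in $\Sigma$ if and only if the integral curves of $l^+$ are geodesics of $(M,g)$. 2. $a_{\mathrm{cen}}=+v\,a_{\mathrm{Cor}}$ holds along all particle worldlines in $\Sigma$ if and only if the integral curves of $l^-$ are geodesics of $(M,g)$. 3. Pointwise version: for each $p\in\Sigma$, the equation $a_{\mathrm{cen}}=\mp v\,a_{\mathrm{Cor}}$ holds at $p$ for all particle worldlines in $\Sigma$ through $p$ if and only if $\nabla_{l^\pm}l^\pm$ is a multiple of $l^\pm$ at $p$ (upper signs together, lower signs together). -/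

import Mathlib

open scoped Manifold ContDiff
open Bundle

noncomputable section

/-- A bilinear form has Lorentzian signature `(+,…,+,-)`: it is symmetric, it is negative on some
vector `v`, and it is positive definite on the orthocomplement of `v`. -/
def IsLorentzForm {V : Type*} [AddCommGroup V] [Module ℝ V] (B : V →ₗ[ℝ] V →ₗ[ℝ] ℝ) : Prop :=
  (∀ v w, B v w = B w v) ∧
    ∃ v, B v v < 0 ∧ ∀ w, B v w = 0 → w ≠ 0 → 0 < B w w

theorem IsLorentzForm.injective {V : Type*} [AddCommGroup V] [Module ℝ V]
    {B : V →ₗ[ℝ] V →ₗ[ℝ] ℝ} (hB : IsLorentzForm B) : Function.Injective B := by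
  obtain ⟨hs, v, hv, hpos⟩ := hB
  rw [injective_iff_map_eq_zero]
  intro w hw
  by_contra hne
  have h := hpos w (by rw [hs, hw]; rfl) hne
  rw [hw] at h
  exact lt_irrefl _ h

section Geometry

variable {E : Type*} [NormedAddCommGroup E] [NormedSpace ℝ E]
  {M : Type*} [TopologicalSpace M] [ChartedSpace E M] [IsManifold 𝓘(ℝ, E) 1 M]

variable (E M) in
/-- A Lorentzian metric of class `C^k` on a manifold `M` modelled on `E`. -/
structure LorentzMetric (k : ℕ∞) where
  /-- The metric tensor at each point. -/
  val (x : M) : TangentSpace 𝓘(ℝ, E) x →L[ℝ] TangentSpace 𝓘(ℝ, E) x →L[ℝ] ℝ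
  lorentz (x : M) : IsLorentzForm (ContinuousLinearMap.coeLM ℝ ∘ₗ (val x).toLinearMap)
  contMDiff : ContMDiff 𝓘(ℝ, E) (𝓘(ℝ, E).prod 𝓘(ℝ, E →L[ℝ] E →L[ℝ] ℝ)) k
    (fun x => TotalSpace.mk' (E →L[ℝ] E →L[ℝ] ℝ) x (val x))

namespace LorentzMetric

variable {k : ℕ∞} (g : LorentzMetric E M k)

/-- Raising an index: `g.sharp x φ` is the vector with `g (g.sharp x φ, c) = φ c` for all `c`. -/
def sharp [FiniteDimensional ℝ E] (x : M) (φ : TangentSpace 𝓘(ℝ, E) x →L[ℝ] ℝ) :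
    TangentSpace 𝓘(ℝ, E) x :=
  haveI : FiniteDimensional ℝ (TangentSpace 𝓘(ℝ, E) x) := inferInstanceAs (FiniteDimensional ℝ E)
  (LinearMap.linearEquivOfInjective
    (ContinuousLinearMap.coeLM ℝ ∘ₗ (g.val x).toLinearMap :
      TangentSpace 𝓘(ℝ, E) x →ₗ[ℝ] Module.Dual ℝ (TangentSpace 𝓘(ℝ, E) x))
    (g.lorentz x).injective Subspace.dual_finrank_eq.symm).symm φ.toLinearMap

theorem val_sharp [FiniteDimensional ℝ E] (x : M) (φ : TangentSpace 𝓘(ℝ, E) x →L[ℝ] ℝ)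
    (c : TangentSpace 𝓘(ℝ, E) x) : g.val x (g.sharp x φ) c = φ c := by
  have : FiniteDimensional ℝ (TangentSpace 𝓘(ℝ, E) x) := inferInstanceAs (FiniteDimensional ℝ E)
  have h := LinearEquiv.apply_symm_apply (LinearMap.linearEquivOfInjective
    (ContinuousLinearMap.coeLM ℝ ∘ₗ (g.val x).toLinearMap :
      TangentSpace 𝓘(ℝ, E) x →ₗ[ℝ] Module.Dual ℝ (TangentSpace 𝓘(ℝ, E) x))
    (g.lorentz x).injective Subspace.dual_finrank_eq.symm) φ.toLinearMap
  exact LinearMap.congr_fun h c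

/-- The metric tensor in the preferred chart at `x`, as a function of the coordinates `y`:
`g.inChart x y a b = g (∑ aⁱ ∂ᵢ, ∑ bʲ ∂ⱼ)` at the point with coordinates `y`. -/
def inChart (x : M) (y : E) : E →L[ℝ] E →L[ℝ] ℝ :=
  let z : M := (extChartAt 𝓘(ℝ, E) x).symm y
  let S : E →L[ℝ] TangentSpace 𝓘(ℝ, E) z :=
    (trivializationAt E (TangentSpace 𝓘(ℝ, E)) x).symmL ℝ z
  (ContinuousLinearMap.precomp ℝ S).comp ((g.val z).comp S)

set_option synthInstance.maxHeartbeats 200000 in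
/-- The Christoffel symbols of the first kind at `x`, in the preferred chart at `x`:
`Γ(a, b; c) = (∂_a g(b, c) + ∂_b g(a, c) - ∂_c g(a, b)) / 2`, as a linear form in `c`. -/
def christoffelFst (x : M) (a b : E) : E →L[ℝ] ℝ :=
  let D : E →L[ℝ] E →L[ℝ] E →L[ℝ] ℝ := fderiv ℝ (g.inChart x) (extChartAt 𝓘(ℝ, E) x x)
  (1 / 2 : ℝ) • (D a b + D b a - (D.flip a).flip b)

/-- The Christoffel symbols `Γ(a, b)` of the Levi-Civita derivative at `x`, in the preferred chart
at `x`; the tangent space at `x` is identified with `E` by that same chart. -/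
def christoffel [FiniteDimensional ℝ E] (x : M) (a b : TangentSpace 𝓘(ℝ, E) x) :
    TangentSpace 𝓘(ℝ, E) x :=
  g.sharp x (g.christoffelFst x a b)

variable {F : Type*} [NormedAddCommGroup F] [NormedSpace ℝ F]
  {N : Type*} [TopologicalSpace N] [ChartedSpace F N]

/-- The Levi-Civita derivative `∇_w Y` of a vector field `Y` along a map `f : N → M`, in the
direction `w` tangent to `N` at `p`: in the preferred chart at `f p` it is
`∂_w Yⁱ + Γⁱ_{jl} (df w)ʲ Yˡ`. -/
def nabla [FiniteDimensional ℝ E] (f : N → M) (Y : ∀ q, TangentSpace 𝓘(ℝ, E) (f q))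
    (p : N) (w : TangentSpace 𝓘(ℝ, F) p) : TangentSpace 𝓘(ℝ, E) (f p) :=
  let Ycoord : N → E := fun q =>
    (trivializationAt E (TangentSpace 𝓘(ℝ, E)) (f p) (TotalSpace.mk' E (f q) (Y q))).2
  let dY : TangentSpace 𝓘(ℝ, E) (f p) := mvfderiv 𝓘(ℝ, F) Ycoord p w
  dY + g.christoffel (f p) (mfderiv 𝓘(ℝ, F) 𝓘(ℝ, E) f p w) (Y p)

/-- The tangent vector field of a curve. -/
def _root_.velocity {X : Type*} [TopologicalSpace X] [ChartedSpace F X] (c : ℝ → X) (t : ℝ) :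
    TangentSpace 𝓘(ℝ, F) (c t) :=
  mfderiv 𝓘(ℝ, ℝ) 𝓘(ℝ, F) c t (1 : ℝ)

/-- A (not necessarily affinely parametrized) geodesic on `J`: `∇_{μ̇} μ̇` is everywhere a multiple
of `μ̇`, and `μ̇` has no zero. -/
def IsGeodesicOn [FiniteDimensional ℝ E] (μ : ℝ → M) (J : Set ℝ) : Prop :=
  ∀ t ∈ J, velocity (F := E) μ t ≠ 0 ∧
    ∃ r : ℝ, g.nabla (F := ℝ) μ (velocity (F := E) μ) t (1 : ℝ) = r • velocity (F := E) μ t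

variable (i : N → M)

/-- The vector field along the map `i` given by a vector field on the domain of `i`. -/
def _root_.pushField (X : ∀ q : N, TangentSpace 𝓘(ℝ, F) q) (q : N) :
    TangentSpace 𝓘(ℝ, E) (i q) :=
  mfderiv 𝓘(ℝ, F) 𝓘(ℝ, E) i q (X q)

/-- The induced metric `i^* g`. -/
def pullback (q : N) : TangentSpace 𝓘(ℝ, F) q →ₗ[ℝ] TangentSpace 𝓘(ℝ, F) q →ₗ[ℝ] ℝ :=
  (ContinuousLinearMap.coeLM ℝ ∘ₗ (g.val (i q)).toLinearMap).compl₁₂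
    (mfderiv 𝓘(ℝ, F) 𝓘(ℝ, E) i q).toLinearMap (mfderiv 𝓘(ℝ, F) 𝓘(ℝ, E) i q).toLinearMap

/-- `i : N → M` is a `C^(k+1)` immersed timelike submanifold: an immersion for which the induced
metric on each tangent space is Lorentzian. -/
structure IsTimelikeSubmanifold : Prop where
  immersion : Manifold.IsImmersion 𝓘(ℝ, F) 𝓘(ℝ, E) (k + 1) i
  lorentz (q : N) : IsLorentzForm (g.pullback (F := F) i q)

/-- `∇_X Y` for vector fields `X`, `Y` on an immersed submanifold `i : N → M`, as a vector field
along `i`; it need not be tangent to the submanifold. -/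
def nablaOn [FiniteDimensional ℝ E] (X Y : ∀ q : N, TangentSpace 𝓘(ℝ, F) q) (q : N) :
    TangentSpace 𝓘(ℝ, E) (i q) :=
  g.nabla i (pushField (E := E) i Y) q (X q)

/-- The Lorentz factor `γ = 1 / √(1 - v²)`. -/
def _root_.lorentzFactor (v : ℝ) : ℝ := 1 / √(1 - v ^ 2)

/-- The Coriolis acceleration at `q`, for a particle with spatial velocity `v` relative to the
observer field `n`. -/
def aCor [FiniteDimensional ℝ E] (n τ : ∀ q : N, TangentSpace 𝓘(ℝ, F) q) (q : N) (v : ℝ) :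
    TangentSpace 𝓘(ℝ, E) (i q) :=
  let nq := pushField (E := E) i n q
  let τq := pushField (E := E) i τ q
  (-(lorentzFactor v ^ 2 * v)) •
    (g.nablaOn i n τ q + g.nablaOn i τ n q
      + g.val (i q) (g.nablaOn i n τ q) nq • nq - g.val (i q) (g.nablaOn i τ n q) τq • τq)

/-- The centrifugal acceleration at `q`, for a particle with spatial velocity `v` relative to the
observer field `n`. -/
def aCen [FiniteDimensional ℝ E] (n τ : ∀ q : N, TangentSpace 𝓘(ℝ, F) q) (q : N) (v : ℝ) :
    TangentSpace 𝓘(ℝ, E) (i q) :=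
  let nq := pushField (E := E) i n q
  let τq := pushField (E := E) i τ q
  (-(lorentzFactor v ^ 2 * v ^ 2)) •
    (g.nablaOn i τ τ q + g.nablaOn i n n q
      + g.val (i q) (g.nablaOn i τ τ q) nq • nq - g.val (i q) (g.nablaOn i n n q) τq • τq)

/-- `c`, defined on the open interval `J`, is a particle worldline in the submanifold: a `C^(k+1)`
curve with 4-velocity `u = ċ` normalized by `g(u, u) = -1`. -/
structure IsWorldline (c : ℝ → N) (J : Set ℝ) : Prop where
  isOpen : IsOpen J
  ordConnected : J.OrdConnected
  contMDiffOn : ContMDiffOn 𝓘(ℝ, ℝ) 𝓘(ℝ, F) (k + 1) c J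
  normalized : ∀ t ∈ J, g.pullback (F := F) i (c t) (velocity c t) (velocity c t) = -1

/-- `v` is the spatial velocity of `c` with respect to `n` and `τ`:
`u = γ (n + v τ)` with `γ = 1 / √(1 - v²)` and `-1 < v < 1`. -/
def _root_.IsSpatialVelocity (n τ : ∀ q : N, TangentSpace 𝓘(ℝ, F) q) (c : ℝ → N) (J : Set ℝ)
    (v : ℝ → ℝ) : Prop :=
  ∀ t ∈ J, v t ∈ Set.Ioo (-1 : ℝ) 1 ∧
    velocity (F := F) c t = lorentzFactor (v t) • (n (c t) + v t • τ (c t))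

/-- All integral curves of the vector field `l` on the submanifold are geodesics of `(M, g)`. -/
def IntegralCurvesAreGeodesics [FiniteDimensional ℝ E] (l : ∀ q : N, TangentSpace 𝓘(ℝ, F) q) :
    Prop :=
  ∀ (c : ℝ → N) (J : Set ℝ), IsOpen J → J.OrdConnected → IsMIntegralCurveOn c l J →
    g.IsGeodesicOn (fun t => i (c t)) J

end LorentzMetric

end Geometry

end

/-! Put `l = n + ε τ` with `ε = ±1`, and let `A` and `C` be the brackets in `a_cen = -γ² v² A` and
`a_Cor = -γ² v C`. For `v ≠ 0` the equation `a_cen = -ε v a_Cor` says `A + ε C = 0`, a condition in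
which `v` no longer occurs. Since `ε² = 1`, `∇_l l = (∇_n n + ∇_τ τ) + ε (∇_n τ + ∇_τ n)`.
Differentiating `g(n, τ) = 0` gives `g(∇_X n, τ) = -g(∇_X τ, n)`, which turns the projection terms
into a multiple of `l`: `A + ε C = ∇_l l + (g(∇_τ τ, n) + ε g(∇_n τ, n)) l`. So `A + ε C = 0` makes
`∇_l l` a multiple of `l`. Conversely, if `∇_l l = r l`, pairing with `n` and using `g(∇_X n, n) =
0` and `g(l, n) = -1` forces `r` to be minus that coefficient. This is
`add_smul_eq_zero_iff_exists_smul`, applied in `aCen_eq_neg_smul_aCor_iff`; metric compatibility is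
`mvfderiv_val`.

Two existence results connect this pointwise identity with curves. `exists_isWorldline` supplies a
worldline with nonzero `v` through each point, and `integralCurvesAreGeodesics_iff` uses an integral
curve of `l` through each point, along which the acceleration is `∇_l l`. -/

open scoped Topology
open Filter

/-! ### Regularity of integral curves. -/

section IntegralCurve

variable {F : Type*} [NormedAddCommGroup F] [NormedSpace ℝ F]

/-- Solutions of an autonomous ODE with `C^k` right-hand side are `C^(k+1)`. -/
theorem contDiffAt_succ_of_eventually_hasDerivAt {f : F → F} {y : ℝ → F} {t₀ : ℝ} {k : ℕ∞}
    (hf : ContDiffAt ℝ k f (y t₀)) (hy : ∀ᶠ t in 𝓝 t₀, HasDerivAt y (f (y t)) t) :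
    ContDiffAt ℝ (k + 1) y t₀ := by
  have succ (m : ℕ) (h : ContDiffAt ℝ m (fun t => f (y t)) t₀) : ContDiffAt ℝ (m + 1) y t₀ := by
    obtain ⟨u, hu, h'⟩ := hy.exists_mem
    refine contDiffAt_succ_iff_hasFDerivAt.2
      ⟨fun t => ContinuousLinearMap.toSpanSingleton ℝ (f (y t)),
        ⟨u, hu, fun t ht => (h' t ht).hasFDerivAt⟩, ?_⟩
    exact (ContinuousLinearMap.toSpanSingletonCLE (𝕜 := ℝ) (E := F)).contDiff.contDiffAt.comp t₀ h
  -- Bootstrapping: `y' = f ∘ y`, so each order of smoothness of `y` yields the next. It starts from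
  -- the continuity of the differentiable function `y`.
  have key (m : ℕ) (hm : ContDiffAt ℝ m f (y t₀)) : ContDiffAt ℝ (m + 1) y t₀ := by
    induction m with
    | zero =>
      obtain ⟨u, hu, h'⟩ := hy.exists_mem
      refine succ _ (hm.comp t₀ (contDiffAt_zero.2 ⟨u, hu, fun t ht => ?_⟩))
      exact (h' t ht).continuousAt.continuousWithinAt
    | succ m ih =>
      refine succ _ (hm.comp t₀ ?_)
      have hm' : ContDiffAt ℝ m f (y t₀) := hm.of_le (by exact_mod_cast Nat.le_succ m)
      exact_mod_cast ih hm'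
  induction k using WithTop.recTopCoe with
  | top =>
    refine contDiffAt_infty.2 fun m => ?_
    exact (key m (hf.of_le (WithTop.coe_le_coe.2 (le_top : (m : ℕ∞) ≤ ⊤)))).of_le
      (by exact_mod_cast Nat.le_succ m)
  | coe m => exact key m hf

variable {S : Type*} [TopologicalSpace S] [ChartedSpace F S] [IsManifold 𝓘(ℝ, F) 1 S]

/-- Integral curves of a `C^k` vector field are `C^(k+1)`. -/
theorem IsMIntegralCurveAt.contMDiffAt {X : ∀ q : S, TangentSpace 𝓘(ℝ, F) q} {c : ℝ → S} {t₀ : ℝ}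
    {k : ℕ∞} (hX : ContMDiffAt 𝓘(ℝ, F) 𝓘(ℝ, F).tangent k
      (fun q => (⟨q, X q⟩ : TangentBundle 𝓘(ℝ, F) S)) (c t₀))
    (hc : IsMIntegralCurveAt c X t₀) : ContMDiffAt 𝓘(ℝ, ℝ) 𝓘(ℝ, F) (k + 1) c t₀ := by
  rw [contMDiffAt_iff] at hX ⊢
  refine ⟨hc.continuousAt, ?_⟩
  have hf := (hX.2.contDiffAt (by simp)).snd
  simp only [mfld_simps]
  rw [contDiffWithinAt_univ]
  refine contDiffAt_succ_of_eventually_hasDerivAt hf ?_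
  have hsrc : ∀ᶠ t in 𝓝 t₀, c t ∈ (extChartAt 𝓘(ℝ, F) (c t₀)).source :=
    hc.continuousAt (extChartAt_source_mem_nhds (I := 𝓘(ℝ, F)) (c t₀))
  filter_upwards [hsrc, hc.eventually_hasDerivAt] with t ht h
  -- The chart inverse returns `c t` only up to a propositional equality, and the fibre of `X`
  -- depends on the point; hence the generalization to `z`.
  have key : ∀ z, z = c t → tangentCoordChange 𝓘(ℝ, F) z (c t₀) z (X z) =
      tangentCoordChange 𝓘(ℝ, F) (c t) (c t₀) (c t) (X (c t)) := by
    rintro _ rfl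
    rfl
  exact h.congr_deriv (key _ ((extChartAt 𝓘(ℝ, F) (c t₀)).left_inv ht)).symm

end IntegralCurve

/-! ### The metric in the preferred chart. -/

namespace LorentzMetric
variable {E : Type*} [NormedAddCommGroup E] [NormedSpace ℝ E]
  {M : Type*} [TopologicalSpace M] [ChartedSpace E M] [IsManifold 𝓘(ℝ, E) 1 M]
variable {k : ℕ∞} (g : LorentzMetric E M k)

theorem inChart_extChartAt {x z : M} (a b : TangentSpace 𝓘(ℝ, E) z)
    (hz : z ∈ (chartAt E x).source) :
    g.inChart x (extChartAt 𝓘(ℝ, E) x z)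
      (trivializationAt E (TangentSpace 𝓘(ℝ, E)) x (TotalSpace.mk' E z a)).2
      (trivializationAt E (TangentSpace 𝓘(ℝ, E)) x (TotalSpace.mk' E z b)).2 = g.val z a b := by
  have key : ∀ z', z' = z → g.val z'
      ((trivializationAt E (TangentSpace 𝓘(ℝ, E)) x).symmL ℝ z'
        (trivializationAt E (TangentSpace 𝓘(ℝ, E)) x (TotalSpace.mk' E z a)).2)
      ((trivializationAt E (TangentSpace 𝓘(ℝ, E)) x).symmL ℝ z'
        (trivializationAt E (TangentSpace 𝓘(ℝ, E)) x (TotalSpace.mk' E z b)).2) =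
      g.val z a b := by
    rintro z' rfl
    have hz' : z' ∈ (trivializationAt E (TangentSpace 𝓘(ℝ, E)) x).baseSet := by simpa using hz
    rw [Trivialization.symmL_apply _ hz', Trivialization.symmL_apply _ hz',
      Trivialization.symm_apply_apply_mk _ hz', Trivialization.symm_apply_apply_mk _ hz']
  exact key _ ((extChartAt 𝓘(ℝ, E) x).left_inv (by simpa using hz))

theorem trivializationAt_tangentSpace_self (x : M) (a : TangentSpace 𝓘(ℝ, E) x) :
    (trivializationAt E (TangentSpace 𝓘(ℝ, E)) x (TotalSpace.mk' E x a)).2 = a :=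
  tangentCoordChange_self (I := 𝓘(ℝ, E)) (mem_extChartAt_source x)

theorem inChart_self (x : M) (a b : E) :
    g.inChart x (extChartAt 𝓘(ℝ, E) x x) a b = g.val x a b := by
  have h := g.inChart_extChartAt (x := x) (z := x) a b (mem_chart_source E x)
  rwa [trivializationAt_tangentSpace_self x a, trivializationAt_tangentSpace_self x b] at h

theorem inChart_symm (x : M) (y a b : E) : g.inChart x y a b = g.inChart x y b a :=
  (g.lorentz _).1 _ _

/-- Composed with the chart, `inChart` is the metric section read in the trivialization of the hom
bundle, hence `C^k`; the chart is then undone on its target. -/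
theorem differentiableAt_inChart [IsManifold 𝓘(ℝ, E) (k + 1) M] (hk : 1 ≤ k) (x : M) :
    DifferentiableAt ℝ (g.inChart x) (extChartAt 𝓘(ℝ, E) x x) := by
  have h := (contMDiffAt_hom_bundle _).1 (g.contMDiff x) |>.2
  have h1 : MDifferentiableAt 𝓘(ℝ, E) 𝓘(ℝ, E →L[ℝ] E →L[ℝ] ℝ)
      (fun z => g.inChart x (extChartAt 𝓘(ℝ, E) x z)) x := by
    have hk' : (k : WithTop ℕ∞) ≠ 0 := by simpa using (zero_lt_one.trans_le hk).ne'
    refine (h.mdifferentiableAt hk').congr_of_eventuallyEq ?_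
    filter_upwards [(chartAt E x).open_source.mem_nhds (mem_chart_source E x)] with z hz
    ext a b
    have hz' : z ∈ (trivializationAt E (TangentSpace 𝓘(ℝ, E)) x).baseSet := by simpa using hz
    refine Eq.trans ?_ (inCoordinates_apply_eq₂ hz' hz' (by simp)).symm
    have key : ∀ z', z' = z → g.val z'
        ((trivializationAt E (TangentSpace 𝓘(ℝ, E)) x).symmL ℝ z' a)
        ((trivializationAt E (TangentSpace 𝓘(ℝ, E)) x).symmL ℝ z' b) =
        g.val z ((trivializationAt E (TangentSpace 𝓘(ℝ, E)) x).symm z a)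
          ((trivializationAt E (TangentSpace 𝓘(ℝ, E)) x).symm z b) := by
      rintro _ rfl
      rw [Trivialization.symmL_apply _ hz', Trivialization.symmL_apply _ hz']
    refine (key _ ((extChartAt 𝓘(ℝ, E) x).left_inv (by simpa using hz))).trans ?_
    simp
  have h2 := ((mdifferentiableAt_iff _ _).1 h1).2.differentiableAt (by simp)
  refine h2.congr_of_eventuallyEq ?_
  filter_upwards [extChartAt_target_mem_nhds (I := 𝓘(ℝ, E)) x] with y hy
  exact congrArg (g.inChart x) ((extChartAt 𝓘(ℝ, E) x).right_inv hy).symm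

end LorentzMetric

/-! ### Components of vector fields along a map. -/

section Components

variable {E : Type*} [NormedAddCommGroup E] [NormedSpace ℝ E]
  {M : Type*} [TopologicalSpace M] [ChartedSpace E M] [IsManifold 𝓘(ℝ, E) 1 M] {N : Type*}

/-- The components of a vector field `Y` along `f`, in the preferred chart at `x`. -/
noncomputable def coordAlong (f : N → M) (Y : ∀ q, TangentSpace 𝓘(ℝ, E) (f q)) (x : M) (q : N) :
    E :=
  (trivializationAt E (TangentSpace 𝓘(ℝ, E)) x (TotalSpace.mk' E (f q) (Y q))).2

theorem coordAlong_add (f : N → M) (Y Z : ∀ q, TangentSpace 𝓘(ℝ, E) (f q)) (x : M) :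
    coordAlong f (Y + Z) x = coordAlong f Y x + coordAlong f Z x :=
  funext fun q => map_add (tangentCoordChange 𝓘(ℝ, E) (f q) x (f q)) (Y q) (Z q)

theorem coordAlong_smul (f : N → M) (r : ℝ) (Y : ∀ q, TangentSpace 𝓘(ℝ, E) (f q)) (x : M) :
    coordAlong f (r • Y) x = r • coordAlong f Y x :=
  funext fun q => map_smul (tangentCoordChange 𝓘(ℝ, E) (f q) x (f q)) r (Y q)

end Components

/-! ### Product rules and componentwise derivatives along a map. -/

section Along
variable {F : Type*} [NormedAddCommGroup F] [NormedSpace ℝ F]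
  {N : Type*} [TopologicalSpace N] [ChartedSpace F N]
  {V W : Type*} [NormedAddCommGroup V] [NormedSpace ℝ V] [NormedAddCommGroup W] [NormedSpace ℝ W]

theorem mvfderiv_clm_apply {A : N → V →L[ℝ] W} {u : N → V} {p : N}
    (hA : MDifferentiableAt 𝓘(ℝ, F) 𝓘(ℝ, V →L[ℝ] W) A p)
    (hu : MDifferentiableAt 𝓘(ℝ, F) 𝓘(ℝ, V) u p) (w : TangentSpace 𝓘(ℝ, F) p) :
    mvfderiv 𝓘(ℝ, F) (fun q => A q (u q)) p w =
      mvfderiv 𝓘(ℝ, F) A p w (u p) + A p (mvfderiv 𝓘(ℝ, F) u p w) := by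
  have hA' := hA.hasMFDerivAt
  have hu' := hu.hasMFDerivAt
  let A' : F →L[ℝ] V →L[ℝ] W := mfderiv 𝓘(ℝ, F) 𝓘(ℝ, V →L[ℝ] W) A p
  let u' : F →L[ℝ] V := mfderiv 𝓘(ℝ, F) 𝓘(ℝ, V) u p
  have h : HasMFDerivAt 𝓘(ℝ, F) 𝓘(ℝ, W) (fun q => A q (u q)) p
      ((A p).comp u' + A'.flip (u p)) := by
    refine ⟨hA'.1.clm_apply hu'.1, ?_⟩
    have h := hA'.2.clm_apply hu'.2
    simp only [mfld_simps] at h ⊢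
    exact h
  rw [mvfderiv, h.mfderiv]
  exact add_comm _ _

-- The three-term Leibniz rule behind metric compatibility: `G` is the metric in a chart, `φ` the
-- coordinates of the base point, `u` and `v` the components of two fields.
set_option synthInstance.maxHeartbeats 200000 in
theorem mvfderiv_bilinear_apply {G : V → V →L[ℝ] V →L[ℝ] W} {φ u v : N → V} {p : N}
    (hG : DifferentiableAt ℝ G (φ p)) (hφ : MDifferentiableAt 𝓘(ℝ, F) 𝓘(ℝ, V) φ p)
    (hu : MDifferentiableAt 𝓘(ℝ, F) 𝓘(ℝ, V) u p) (hv : MDifferentiableAt 𝓘(ℝ, F) 𝓘(ℝ, V) v p)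
    (w : TangentSpace 𝓘(ℝ, F) p) :
    mvfderiv 𝓘(ℝ, F) (fun q => G (φ q) (u q) (v q)) p w =
      fderiv ℝ G (φ p) (mvfderiv 𝓘(ℝ, F) φ p w) (u p) (v p) +
        G (φ p) (mvfderiv 𝓘(ℝ, F) u p w) (v p) + G (φ p) (u p) (mvfderiv 𝓘(ℝ, F) v p w) := by
  have hGφ : MDifferentiableAt 𝓘(ℝ, F) 𝓘(ℝ, V →L[ℝ] V →L[ℝ] W) (fun q => G (φ q)) p :=
    hG.mdifferentiableAt.comp p hφ
  have h : mvfderiv 𝓘(ℝ, F) (fun q => G (φ q)) p w =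
      fderiv ℝ G (φ p) (mvfderiv 𝓘(ℝ, F) φ p w) := by
    refine (mfderiv_comp_apply p hG.mdifferentiableAt hφ w).trans ?_
    rw [mfderiv_eq_fderiv]
    rfl
  rw [mvfderiv_clm_apply (hGφ.clm_apply hu) hv, mvfderiv_clm_apply hGφ hu, h]
  rfl

variable {E : Type*} [NormedAddCommGroup E] [NormedSpace ℝ E]
  {M : Type*} [TopologicalSpace M] [ChartedSpace E M] [IsManifold 𝓘(ℝ, E) 1 M]

/-- The componentwise derivative of a vector field `Y` along `f` in the direction `w`, in the
preferred chart at `f p`. -/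
noncomputable def coordDeriv (f : N → M) (Y : ∀ q, TangentSpace 𝓘(ℝ, E) (f q)) (p : N)
    (w : TangentSpace 𝓘(ℝ, F) p) : TangentSpace 𝓘(ℝ, E) (f p) :=
  mvfderiv 𝓘(ℝ, F) (coordAlong f Y (f p)) p w

variable {f : N → M} {Y Z : ∀ q, TangentSpace 𝓘(ℝ, E) (f q)} {p : N}

theorem coordDeriv_add_direction (w w' : TangentSpace 𝓘(ℝ, F) p) :
    coordDeriv f Y p (w + w') = coordDeriv f Y p w + coordDeriv f Y p w' :=
  map_add (mvfderiv 𝓘(ℝ, F) (coordAlong f Y (f p)) p) w w'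

theorem coordDeriv_smul_direction (r : ℝ) (w : TangentSpace 𝓘(ℝ, F) p) :
    coordDeriv f Y p (r • w) = r • coordDeriv f Y p w :=
  map_smul (mvfderiv 𝓘(ℝ, F) (coordAlong f Y (f p)) p) r w

theorem coordDeriv_add (hY : MDifferentiableAt 𝓘(ℝ, F) 𝓘(ℝ, E) (coordAlong f Y (f p)) p)
    (hZ : MDifferentiableAt 𝓘(ℝ, F) 𝓘(ℝ, E) (coordAlong f Z (f p)) p)
    (w : TangentSpace 𝓘(ℝ, F) p) :
    coordDeriv f (Y + Z) p w = coordDeriv f Y p w + coordDeriv f Z p w := by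
  rw [coordDeriv, coordAlong_add, mvfderiv_add hY hZ]
  rfl

theorem coordDeriv_smul (r : ℝ)
    (hY : MDifferentiableAt 𝓘(ℝ, F) 𝓘(ℝ, E) (coordAlong f Y (f p)) p)
    (w : TangentSpace 𝓘(ℝ, F) p) :
    coordDeriv f (r • Y) p w = r • coordDeriv f Y p w := by
  rw [coordDeriv, coordAlong_smul, mvfderiv, const_smul_mfderiv hY]
  rfl

end Along

/-! ### Christoffel symbols, and linearity and metric compatibility of the derivative. -/

namespace LorentzMetric
variable {E : Type*} [NormedAddCommGroup E] [NormedSpace ℝ E]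
  {M : Type*} [TopologicalSpace M] [ChartedSpace E M] [IsManifold 𝓘(ℝ, E) 1 M]
  {F : Type*} [NormedAddCommGroup F] [NormedSpace ℝ F]
  {N : Type*} [TopologicalSpace N] [ChartedSpace F N]
variable {k : ℕ∞} (g : LorentzMetric E M k)

theorem val_symm (x : M) (a b : TangentSpace 𝓘(ℝ, E) x) : g.val x a b = g.val x b a :=
  (g.lorentz x).1 a b

set_option synthInstance.maxHeartbeats 200000 in
theorem christoffelFst_apply (x : M) (a b c : E) :
    g.christoffelFst x a b c = 1 / 2 *
      (fderiv ℝ (g.inChart x) (extChartAt 𝓘(ℝ, E) x x) a b c +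
        fderiv ℝ (g.inChart x) (extChartAt 𝓘(ℝ, E) x x) b a c -
        fderiv ℝ (g.inChart x) (extChartAt 𝓘(ℝ, E) x x) c a b) := rfl

set_option synthInstance.maxHeartbeats 200000 in
theorem christoffelFst_add_left (x : M) (a a' b : E) :
    g.christoffelFst x (a + a') b = g.christoffelFst x a b + g.christoffelFst x a' b := by
  ext c
  simp only [christoffelFst_apply, map_add, add_apply]
  ring

set_option synthInstance.maxHeartbeats 200000 in
theorem christoffelFst_add_right (x : M) (a b b' : E) :
    g.christoffelFst x a (b + b') = g.christoffelFst x a b + g.christoffelFst x a b' := by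
  ext c
  simp only [christoffelFst_apply, map_add, add_apply]
  ring

set_option synthInstance.maxHeartbeats 200000 in
theorem christoffelFst_smul_left (x : M) (r : ℝ) (a b : E) :
    g.christoffelFst x (r • a) b = r • g.christoffelFst x a b := by
  ext c
  simp only [christoffelFst_apply, map_smul, smul_apply, smul_eq_mul]
  ring

set_option synthInstance.maxHeartbeats 200000 in
theorem christoffelFst_smul_right (x : M) (r : ℝ) (a b : E) :
    g.christoffelFst x a (r • b) = r • g.christoffelFst x a b := by
  ext c
  simp only [christoffelFst_apply, map_smul, smul_apply, smul_eq_mul]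
  ring

/-- Metric compatibility at the level of Christoffel symbols: the derivative of `g` inherits the
symmetry of `g`, so the terms differentiated along `b` and `c` cancel. -/
theorem christoffelFst_add_christoffelFst [IsManifold 𝓘(ℝ, E) (k + 1) M] (hk : 1 ≤ k) (x : M)
    (a b c : E) :
    g.christoffelFst x a b c + g.christoffelFst x a c b =
      fderiv ℝ (g.inChart x) (extChartAt 𝓘(ℝ, E) x x) a b c := by
  have hd := g.differentiableAt_inChart hk x
  have hD (u v : E) : (fun y => g.inChart x y u v) = fun y => g.inChart x y v u :=
    funext fun y => g.inChart_symm x y u v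
  have hD' (e u v : E) : fderiv ℝ (fun y => g.inChart x y u v) (extChartAt 𝓘(ℝ, E) x x) e =
      fderiv ℝ (g.inChart x) (extChartAt 𝓘(ℝ, E) x x) e u v := by
    rw [((hd.hasFDerivAt.clm_apply (hasFDerivAt_const u _)).clm_apply
      (hasFDerivAt_const v _)).fderiv]
    simp
  have symm (e u v : E) : fderiv ℝ (g.inChart x) (extChartAt 𝓘(ℝ, E) x x) e u v =
      fderiv ℝ (g.inChart x) (extChartAt 𝓘(ℝ, E) x x) e v u := by
    rw [← hD', hD, hD']
  rw [christoffelFst_apply, christoffelFst_apply, symm a c b, symm b a c, symm c a b]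
  ring

section Sharp
variable [FiniteDimensional ℝ E]

theorem sharp_add (x : M) (φ ψ : TangentSpace 𝓘(ℝ, E) x →L[ℝ] ℝ) :
    g.sharp x (φ + ψ) = g.sharp x φ + g.sharp x ψ := by
  simp [sharp]

theorem sharp_smul (x : M) (r : ℝ) (φ : TangentSpace 𝓘(ℝ, E) x →L[ℝ] ℝ) :
    g.sharp x (r • φ) = r • g.sharp x φ := by
  simp [sharp]

theorem christoffel_add_left (x : M) (a a' b : TangentSpace 𝓘(ℝ, E) x) :
    g.christoffel x (a + a') b = g.christoffel x a b + g.christoffel x a' b := by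
  exact (congrArg (g.sharp x) (g.christoffelFst_add_left x a a' b)).trans
    (g.sharp_add x _ _)

theorem christoffel_add_right (x : M) (a b b' : TangentSpace 𝓘(ℝ, E) x) :
    g.christoffel x a (b + b') = g.christoffel x a b + g.christoffel x a b' := by
  exact (congrArg (g.sharp x) (g.christoffelFst_add_right x a b b')).trans
    (g.sharp_add x _ _)

theorem christoffel_smul_left (x : M) (r : ℝ) (a b : TangentSpace 𝓘(ℝ, E) x) :
    g.christoffel x (r • a) b = r • g.christoffel x a b := by
  exact (congrArg (g.sharp x) (g.christoffelFst_smul_left x r a b)).trans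
    (g.sharp_smul x _ _)

theorem christoffel_smul_right (x : M) (r : ℝ) (a b : TangentSpace 𝓘(ℝ, E) x) :
    g.christoffel x a (r • b) = r • g.christoffel x a b := by
  exact (congrArg (g.sharp x) (g.christoffelFst_smul_right x r a b)).trans
    (g.sharp_smul x _ _)

theorem val_christoffel (x : M) (a b c : TangentSpace 𝓘(ℝ, E) x) :
    g.val x (g.christoffel x a b) c = g.christoffelFst x a b c :=
  g.val_sharp x _ c

end Sharp

variable {f : N → M} {Y Z : ∀ q, TangentSpace 𝓘(ℝ, E) (f q)} {p : N} [FiniteDimensional ℝ E]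

theorem nabla_def (w : TangentSpace 𝓘(ℝ, F) p) : g.nabla f Y p w =
    coordDeriv f Y p w +
      g.christoffel (f p) (mfderiv 𝓘(ℝ, F) 𝓘(ℝ, E) f p w) (Y p) := rfl

theorem nabla_add_direction (w w' : TangentSpace 𝓘(ℝ, F) p) :
    g.nabla f Y p (w + w') = g.nabla f Y p w + g.nabla f Y p w' := by
  simp only [nabla_def, coordDeriv_add_direction, map_add, christoffel_add_left]
  abel

theorem nabla_smul_direction (r : ℝ) (w : TangentSpace 𝓘(ℝ, F) p) :
    g.nabla f Y p (r • w) = r • g.nabla f Y p w := by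
  simp only [nabla_def, coordDeriv_smul_direction, map_smul, christoffel_smul_left, smul_add]

theorem nabla_add (hY : MDifferentiableAt 𝓘(ℝ, F) 𝓘(ℝ, E) (coordAlong f Y (f p)) p)
    (hZ : MDifferentiableAt 𝓘(ℝ, F) 𝓘(ℝ, E) (coordAlong f Z (f p)) p)
    (w : TangentSpace 𝓘(ℝ, F) p) :
    g.nabla f (Y + Z) p w = g.nabla f Y p w + g.nabla f Z p w := by
  simp only [nabla_def, coordDeriv_add hY hZ, Pi.add_apply, christoffel_add_right]
  abel

theorem nabla_smul (r : ℝ) (hY : MDifferentiableAt 𝓘(ℝ, F) 𝓘(ℝ, E) (coordAlong f Y (f p)) p)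
    (w : TangentSpace 𝓘(ℝ, F) p) :
    g.nabla f (r • Y) p w = r • g.nabla f Y p w := by
  simp only [nabla_def, coordDeriv_smul r hY, Pi.smul_apply, christoffel_smul_right, smul_add]

/-- Allows the velocity of an integral curve to be replaced by the generating field, with which it
agrees only near the given parameter. -/
theorem nabla_congr (h : ∀ᶠ q in 𝓝 p, Y q = Z q) (w : TangentSpace 𝓘(ℝ, F) p) :
    g.nabla f Y p w = g.nabla f Z p w := by
  have h' : coordAlong f Y (f p) =ᶠ[𝓝 p] coordAlong f Z (f p) :=
    h.mono fun q hq => by rw [coordAlong, hq]; rfl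
  rw [nabla_def, nabla_def, h.self_of_nhds, coordDeriv, coordDeriv, mvfderiv, mvfderiv,
    h'.mfderiv_eq]
  rfl

/-- Chain rule for the Levi-Civita derivative along a map. -/
theorem nabla_comp {F' : Type*} [NormedAddCommGroup F'] [NormedSpace ℝ F']
    {N' : Type*} [TopologicalSpace N'] [ChartedSpace F' N'] {c : N' → N} {t : N'}
    (hf : MDifferentiableAt 𝓘(ℝ, F) 𝓘(ℝ, E) f (c t))
    (hY : MDifferentiableAt 𝓘(ℝ, F) 𝓘(ℝ, E) (coordAlong f Y (f (c t))) (c t))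
    (hc : MDifferentiableAt 𝓘(ℝ, F') 𝓘(ℝ, F) c t) (w : TangentSpace 𝓘(ℝ, F') t) :
    g.nabla (fun s => f (c s)) (fun s => Y (c s)) t w =
      g.nabla f Y (c t) (mfderiv 𝓘(ℝ, F') 𝓘(ℝ, F) c t w) := by
  rw [nabla_def, nabla_def]
  congr 1
  · exact mfderiv_comp_apply t hY hc w
  · congr 1
    exact mfderiv_comp_apply t hf hc w

/-- The Levi-Civita derivative along a map is compatible with the metric. -/
theorem mvfderiv_val [IsManifold 𝓘(ℝ, E) (k + 1) M] (hk : 1 ≤ k)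
    (hf : MDifferentiableAt 𝓘(ℝ, F) 𝓘(ℝ, E) f p)
    (hY : MDifferentiableAt 𝓘(ℝ, F) 𝓘(ℝ, E) (coordAlong f Y (f p)) p)
    (hZ : MDifferentiableAt 𝓘(ℝ, F) 𝓘(ℝ, E) (coordAlong f Z (f p)) p)
    (w : TangentSpace 𝓘(ℝ, F) p) :
    mvfderiv 𝓘(ℝ, F) (fun q => g.val (f q) (Y q) (Z q)) p w =
      g.val (f p) (g.nabla f Y p w) (Z p) + g.val (f p) (Y p) (g.nabla f Z p w) := by
  have hφ : MDifferentiableAt 𝓘(ℝ, F) 𝓘(ℝ, E) (fun q => extChartAt 𝓘(ℝ, E) (f p) (f q)) p :=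
    (mdifferentiableAt_extChartAt (mem_chart_source E (f p))).comp p hf
  -- The tangent space at `f p` is identified with `E` by this very chart, whose derivative there is
  -- therefore the identity.
  have hdφ : mvfderiv 𝓘(ℝ, F) (fun q => extChartAt 𝓘(ℝ, E) (f p) (f q)) p w =
      mfderiv 𝓘(ℝ, F) 𝓘(ℝ, E) f p w := by
    refine (mfderiv_comp_apply p (mdifferentiableAt_extChartAt (mem_chart_source E (f p))) hf
      w).trans ?_
    rw [mfderiv_extChartAt_self]
    rfl
  have hev : (fun q => g.val (f q) (Y q) (Z q)) =ᶠ[𝓝 p] fun q =>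
      g.inChart (f p) (extChartAt 𝓘(ℝ, E) (f p) (f q)) (coordAlong f Y (f p) q)
        (coordAlong f Z (f p) q) := by
    filter_upwards [hf.continuousAt (chart_source_mem_nhds E (f p))] with q hq
    exact (g.inChart_extChartAt (Y q) (Z q) hq).symm
  have hself (Y : ∀ q, TangentSpace 𝓘(ℝ, E) (f q)) : coordAlong f Y (f p) p = Y p :=
    trivializationAt_tangentSpace_self (f p) (Y p)
  have hd' := mvfderiv_bilinear_apply (φ := fun q => extChartAt 𝓘(ℝ, E) (f p) (f q)) (p := p)
    (g.differentiableAt_inChart hk (f p)) hφ hY hZ w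
  have hd : mvfderiv 𝓘(ℝ, F) (fun q => g.val (f q) (Y q) (Z q)) p w = _ :=
    Eq.trans (by rw [mvfderiv, mvfderiv, hev.mfderiv_eq]; rfl) hd'
  have hΓ := g.christoffelFst_add_christoffelFst hk (f p)
    (mfderiv 𝓘(ℝ, F) 𝓘(ℝ, E) f p w) (Y p) (Z p)
  have h1 : g.val (f p) (g.nabla f Y p w) (Z p) = g.val (f p) (coordDeriv f Y p w) (Z p) +
      g.christoffelFst (f p) (mfderiv 𝓘(ℝ, F) 𝓘(ℝ, E) f p w) (Y p) (Z p) := by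
    rw [nabla_def, map_add, add_apply, val_christoffel]
  have h2 : g.val (f p) (Y p) (g.nabla f Z p w) = g.val (f p) (Y p) (coordDeriv f Z p w) +
      g.christoffelFst (f p) (mfderiv 𝓘(ℝ, F) 𝓘(ℝ, E) f p w) (Z p) (Y p) := by
    rw [nabla_def, map_add, g.val_symm _ (Y p) (christoffel _ _ _ _), val_christoffel]
  have hYZ : g.inChart (f p) (extChartAt 𝓘(ℝ, E) (f p) (f p))
      (mvfderiv 𝓘(ℝ, F) (coordAlong f Y (f p)) p w) (Z p) =
        g.val (f p) (coordDeriv f Y p w) (Z p) := g.inChart_self (f p) _ _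
  have hZY : g.inChart (f p) (extChartAt 𝓘(ℝ, E) (f p) (f p)) (Y p)
      (mvfderiv 𝓘(ℝ, F) (coordAlong f Z (f p)) p w) =
        g.val (f p) (Y p) (coordDeriv f Z p w) := g.inChart_self (f p) _ _
  rw [hd, h1, h2, hdφ, hself, hself, ← hΓ, hYZ, hZY]
  ring

end LorentzMetric

/-! ### Pointwise algebra of the two accelerations. -/

theorem lorentzFactor_sq {v : ℝ} (hv : v ∈ Set.Ioo (-1 : ℝ) 1) :
    lorentzFactor v ^ 2 * (1 - v ^ 2) = 1 := by
  have h : 0 < 1 - v ^ 2 := by nlinarith [hv.1, hv.2]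
  rw [lorentzFactor, div_pow, Real.sq_sqrt h.le]
  field_simp

/-- The algebra behind the comparison of the Coriolis and centrifugal accelerations: `a`, `b`, `c`,
`d` play the role of `∇_n n`, `∇_n τ`, `∇_τ n`, `∇_τ τ`. -/
theorem add_smul_eq_zero_iff_exists_smul {V : Type*} [AddCommGroup V] [Module ℝ V]
    (B : V →ₗ[ℝ] V →ₗ[ℝ] ℝ) {n τ a b c d : V} {ε : ℝ} (hε : ε * ε = 1) (hnn : B n n = -1)
    (hτn : B τ n = 0) (han : B a n = 0) (hcn : B c n = 0) (hab : B a τ = -B b n)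
    (hcd : B c τ = -B d n) :
    (d + a + B d n • n - B a τ • τ) + ε • (b + c + B b n • n - B c τ • τ) = 0 ↔
      ∃ r : ℝ, a + ε • c + ε • (b + ε • d) = r • (n + ε • τ) := by
  have key : (d + a + B d n • n - B a τ • τ) + ε • (b + c + B b n • n - B c τ • τ) =
      (a + ε • c + ε • (b + ε • d)) + (B d n + ε * B b n) • (n + ε • τ) := by
    rw [hab, hcd]
    linear_combination (norm := module) (-hε) • d - (B b n * hε) • τ
  rw [key]
  constructor
  · intro h
    exact ⟨-(B d n + ε * B b n), by rw [neg_smul]; exact eq_neg_of_add_eq_zero_left h⟩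
  · rintro ⟨r, hr⟩
    -- Pairing with `n` determines `r`, because `B (n + ε τ) n = -1`.
    have h := congrArg (fun x => B x n) hr
    simp only [map_add, map_smul, LinearMap.add_apply, LinearMap.smul_apply, smul_eq_mul, han, hcn,
      hnn, hτn] at h
    have hr' : r = -(B d n + ε * B b n) := by linear_combination h - B d n * hε
    rw [hr, hr', neg_smul, neg_add_cancel]

theorem neg_smul_eq_neg_smul_smul_iff {V : Type*} [AddCommGroup V] [Module ℝ V] {x y : V}
    {γ v ε : ℝ} (h : γ ^ 2 * v ^ 2 ≠ 0) :
    (-(γ ^ 2 * v ^ 2)) • x = -(ε * v) • (-(γ ^ 2 * v)) • y ↔ x + ε • y = 0 := by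
  have key : (γ ^ 2 * v ^ 2) • (x + ε • y) =
      -(ε * v) • (-(γ ^ 2 * v)) • y - (-(γ ^ 2 * v ^ 2)) • x := by
    module
  rw [eq_comm, ← sub_eq_zero, ← key, smul_eq_zero_iff_right h]

/-! ### Fields pushed forward along the immersion, and existence of integral curves. -/

section PushField

variable {E : Type*} [NormedAddCommGroup E] [NormedSpace ℝ E]
  {M : Type*} [TopologicalSpace M] [ChartedSpace E M]
  {F : Type*} [NormedAddCommGroup F] [NormedSpace ℝ F]
  {S : Type*} [TopologicalSpace S] [ChartedSpace F S]

theorem pushField_add (i : S → M) (X Y : ∀ q : S, TangentSpace 𝓘(ℝ, F) q) :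
    pushField (E := E) i (X + Y) = pushField i X + pushField i Y :=
  funext fun q => map_add (mfderiv 𝓘(ℝ, F) 𝓘(ℝ, E) i q) (X q) (Y q)

theorem pushField_smul (i : S → M) (r : ℝ) (X : ∀ q : S, TangentSpace 𝓘(ℝ, F) q) :
    pushField (E := E) i (r • X) = r • pushField i X :=
  funext fun q => map_smul (mfderiv 𝓘(ℝ, F) 𝓘(ℝ, E) i q) r (X q)

theorem IsMIntegralCurveAt.velocity_eq {X : ∀ q : S, TangentSpace 𝓘(ℝ, F) q} {c : ℝ → S} {t : ℝ}
    (hc : IsMIntegralCurveAt c X t) : velocity (F := F) c t = X (c t) := by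
  rw [velocity, hc.hasMFDerivAt.mfderiv]
  exact one_smul ℝ (X (c t))

variable [IsManifold 𝓘(ℝ, E) 1 M] [IsManifold 𝓘(ℝ, F) 1 S] {k : ℕ∞}

/-- The pushed field is the tangent map of `i` composed with `X`; the tangent map costs one
derivative, so a `C^(k+1)` map `i` leaves class `C^k`. -/
theorem mdifferentiableAt_coordAlong_pushField (hk : 1 ≤ k) {i : S → M}
    (hi : ContMDiff 𝓘(ℝ, F) 𝓘(ℝ, E) (k + 1) i) {X : ∀ q : S, TangentSpace 𝓘(ℝ, F) q}
    (hX : ContMDiff 𝓘(ℝ, F) 𝓘(ℝ, F).tangent k fun q => (⟨q, X q⟩ : TangentBundle 𝓘(ℝ, F) S))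
    (p : S) :
    MDifferentiableAt 𝓘(ℝ, F) 𝓘(ℝ, E) (coordAlong i (pushField (E := E) i X) (i p)) p := by
  have h : ContMDiff 𝓘(ℝ, F) 𝓘(ℝ, E).tangent k
      fun q => (⟨i q, pushField (E := E) i X q⟩ : TangentBundle 𝓘(ℝ, E) M) :=
    (hi.contMDiff_tangentMap le_rfl).comp hX
  have hk' : (k : WithTop ℕ∞) ≠ 0 := by simpa using (zero_lt_one.trans_le hk).ne'
  exact ((mdifferentiableAt_totalSpace _ _).1 (h.mdifferentiable hk' p)).2

theorem exists_isMIntegralCurveOn_ball [CompleteSpace F] (hk : 1 ≤ k)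
    {X : ∀ q : S, TangentSpace 𝓘(ℝ, F) q}
    (hX : ContMDiff 𝓘(ℝ, F) 𝓘(ℝ, F).tangent k fun q => (⟨q, X q⟩ : TangentBundle 𝓘(ℝ, F) S))
    (p : S) : ∃ (c : ℝ → S) (δ : ℝ), 0 < δ ∧ c 0 = p ∧ IsMIntegralCurveOn c X (Metric.ball 0 δ) := by
  obtain ⟨c, hc0, hc⟩ := exists_isMIntegralCurveAt_of_contMDiffAt_boundaryless 0
    ((hX p).of_le (by exact_mod_cast hk))
  obtain ⟨δ, hδ, h⟩ := isMIntegralCurveAt_iff'.1 hc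
  exact ⟨c, δ, hδ, hc0, h⟩

end PushField

/-! ### Worldlines, geodesics and the equivalences. -/

namespace LorentzMetric

variable {E : Type*} [NormedAddCommGroup E] [NormedSpace ℝ E]
  {M : Type*} [TopologicalSpace M] [ChartedSpace E M] [IsManifold 𝓘(ℝ, E) 1 M]
  {F : Type*} [NormedAddCommGroup F] [NormedSpace ℝ F]
  {S : Type*} [TopologicalSpace S] [ChartedSpace F S] [IsManifold 𝓘(ℝ, F) 1 S]
  {k : ℕ∞} (g : LorentzMetric E M k) {i : S → M}
  {n τ : ∀ q : S, TangentSpace 𝓘(ℝ, F) q}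

/-- Through every point there is a worldline of any constant spatial velocity `v`, `|v| < 1`. -/
theorem exists_isWorldline [CompleteSpace F] (hk : 1 ≤ k)
    (hn : ContMDiff 𝓘(ℝ, F) 𝓘(ℝ, F).tangent k fun q => (⟨q, n q⟩ : TangentBundle 𝓘(ℝ, F) S))
    (hτ : ContMDiff 𝓘(ℝ, F) 𝓘(ℝ, F).tangent k fun q => (⟨q, τ q⟩ : TangentBundle 𝓘(ℝ, F) S))
    (hnn : ∀ q, g.pullback i q (n q) (n q) = -1)
    (hnτ : ∀ q, g.pullback i q (n q) (τ q) = 0)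
    (hττ : ∀ q, g.pullback i q (τ q) (τ q) = 1) (p : S) {v : ℝ} (hv : v ∈ Set.Ioo (-1 : ℝ) 1) :
    ∃ (c : ℝ → S) (J : Set ℝ), g.IsWorldline (F := F) i c J ∧
      IsSpatialVelocity n τ c J (fun _ => v) ∧ 0 ∈ J ∧ c 0 = p := by
  -- The worldline is an integral curve of `γ (n + v τ)` with `v` constant.
  have hX : ContMDiff 𝓘(ℝ, F) 𝓘(ℝ, F).tangent k fun q =>
      (⟨q, (lorentzFactor v • (n + v • τ)) q⟩ : TangentBundle 𝓘(ℝ, F) S) :=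
    (hn.add_section hτ.const_smul_section).const_smul_section
  obtain ⟨c, δ, hδ, hc0, hc⟩ := exists_isMIntegralCurveOn_ball hk hX p
  have hcA := (isMIntegralCurveOn_iff_isMIntegralCurveAt Metric.isOpen_ball).1 hc
  refine ⟨c, Metric.ball 0 δ, ⟨Metric.isOpen_ball, (convex_ball (0 : ℝ) δ).ordConnected,
    fun t ht => ((hcA t ht).contMDiffAt (hX _)).contMDiffWithinAt, fun t ht => ?_⟩,
    fun t ht => ⟨hv, (hcA t ht).velocity_eq⟩, Metric.mem_ball_self hδ, hc0⟩
  have hτn : g.pullback i (c t) (τ (c t)) (n (c t)) = 0 :=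
    ((g.lorentz _).1 _ _).trans (hnτ _)
  rw [(hcA t ht).velocity_eq]
  simp only [Pi.smul_apply, Pi.add_apply, map_smul, map_add, LinearMap.smul_apply,
    LinearMap.add_apply, hnn, hnτ, hττ, hτn, smul_eq_mul]
  linear_combination -lorentzFactor_sq hv

variable [FiniteDimensional ℝ E]

/-- Along an integral curve the velocity of `i ∘ c` is the pushed field, so by locality and the
chain rule its acceleration is `∇_l l`. -/
theorem isGeodesicOn_comp_iff (hk : 1 ≤ k) (hi : ContMDiff 𝓘(ℝ, F) 𝓘(ℝ, E) (k + 1) i)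
    {l : ∀ q : S, TangentSpace 𝓘(ℝ, F) q}
    (hl : ContMDiff 𝓘(ℝ, F) 𝓘(ℝ, F).tangent k fun q => (⟨q, l q⟩ : TangentBundle 𝓘(ℝ, F) S))
    {c : ℝ → S} {J : Set ℝ} (hJ : IsOpen J) (hc : IsMIntegralCurveOn c l J) :
    g.IsGeodesicOn (fun t => i (c t)) J ↔ ∀ t ∈ J, pushField (E := E) i l (c t) ≠ 0 ∧
      ∃ r : ℝ, g.nablaOn i l l (c t) = r • pushField (E := E) i l (c t) := by
  have hid : MDifferentiable 𝓘(ℝ, F) 𝓘(ℝ, E) i := hi.mdifferentiable (by simp)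
  have hcA := (isMIntegralCurveOn_iff_isMIntegralCurveAt hJ).1 hc
  have hvel : ∀ t ∈ J, velocity (F := E) (fun t => i (c t)) t = pushField (E := E) i l (c t) := by
    intro t ht
    refine (mfderiv_comp_apply t (hid (c t)) (hcA t ht).hasMFDerivAt.mdifferentiableAt 1).trans ?_
    exact congrArg _ (hcA t ht).velocity_eq
  refine forall₂_congr fun t ht => ?_
  have hn : g.nabla (F := ℝ) (fun t => i (c t)) (velocity (F := E) fun t => i (c t)) t (1 : ℝ) =
      g.nablaOn i l l (c t) := by
    refine (g.nabla_congr (Z := fun s => pushField (E := E) i l (c s))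
      (eventually_of_mem (hJ.mem_nhds ht) hvel) _).trans ?_
    refine (g.nabla_comp (hid (c t)) (mdifferentiableAt_coordAlong_pushField hk hi hl (c t))
      (hcA t ht).hasMFDerivAt.mdifferentiableAt _).trans ?_
    exact congrArg _ (hcA t ht).velocity_eq
  rw [hn, hvel t ht]

/-- The integral curves of a nowhere vanishing field `l` are geodesics iff `∇_l l` is a multiple of
`l` at every point. -/
theorem integralCurvesAreGeodesics_iff [CompleteSpace F] (hk : 1 ≤ k)
    (hi : ContMDiff 𝓘(ℝ, F) 𝓘(ℝ, E) (k + 1) i)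
    {l : ∀ q : S, TangentSpace 𝓘(ℝ, F) q}
    (hl : ContMDiff 𝓘(ℝ, F) 𝓘(ℝ, F).tangent k fun q => (⟨q, l q⟩ : TangentBundle 𝓘(ℝ, F) S))
    (hl0 : ∀ q, pushField (E := E) i l q ≠ 0) :
    g.IntegralCurvesAreGeodesics i l ↔
      ∀ p, ∃ r : ℝ, g.nablaOn i l l p = r • pushField (E := E) i l p := by
  constructor
  · intro h p
    obtain ⟨c, δ, hδ, rfl, hc⟩ := exists_isMIntegralCurveOn_ball hk hl p
    refine ((g.isGeodesicOn_comp_iff hk hi hl Metric.isOpen_ball hc).1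
      (h c _ Metric.isOpen_ball ?_ hc) 0 (Metric.mem_ball_self hδ)).2
    exact (convex_ball (0 : ℝ) δ).ordConnected
  · intro h c J hJ _ hc
    exact (g.isGeodesicOn_comp_iff hk hi hl hJ hc).2 fun t _ => ⟨hl0 _, h _⟩

variable [IsManifold 𝓘(ℝ, E) (k + 1) M]

/-- Metric compatibility applied to a constant product `g(X, Y) = r`. -/
theorem val_nablaOn_add_val_nablaOn (hk : 1 ≤ k) (hi : ContMDiff 𝓘(ℝ, F) 𝓘(ℝ, E) (k + 1) i)
    {X Y : ∀ q : S, TangentSpace 𝓘(ℝ, F) q}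
    (hX : ContMDiff 𝓘(ℝ, F) 𝓘(ℝ, F).tangent k fun q => (⟨q, X q⟩ : TangentBundle 𝓘(ℝ, F) S))
    (hY : ContMDiff 𝓘(ℝ, F) 𝓘(ℝ, F).tangent k fun q => (⟨q, Y q⟩ : TangentBundle 𝓘(ℝ, F) S))
    {r : ℝ} (h : ∀ q, g.pullback i q (X q) (Y q) = r) (Z : ∀ q : S, TangentSpace 𝓘(ℝ, F) q)
    (p : S) :
    g.val (i p) (g.nablaOn i Z X p) (pushField i Y p) +
      g.val (i p) (g.nablaOn i Z Y p) (pushField i X p) = 0 := by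
  have h' := g.mvfderiv_val hk (hi.mdifferentiable (by simp) p)
    (mdifferentiableAt_coordAlong_pushField hk hi hX p)
    (mdifferentiableAt_coordAlong_pushField hk hi hY p) (Z p)
  have hc : (fun q => g.val (i q) (pushField i X q) (pushField i Y q)) = fun _ => r := funext h
  rw [hc, mvfderiv_const, g.val_symm _ (pushField i X p)] at h'
  exact h'.symm

/-- At a fixed nonzero spatial velocity, `a_cen = -ε v a_Cor` iff `∇_l l` is a multiple of
`l = n + ε τ`, where `ε = ±1`. -/
theorem aCen_eq_neg_smul_aCor_iff (hk : 1 ≤ k) (hi : ContMDiff 𝓘(ℝ, F) 𝓘(ℝ, E) (k + 1) i)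
    (hn : ContMDiff 𝓘(ℝ, F) 𝓘(ℝ, F).tangent k fun q => (⟨q, n q⟩ : TangentBundle 𝓘(ℝ, F) S))
    (hτ : ContMDiff 𝓘(ℝ, F) 𝓘(ℝ, F).tangent k fun q => (⟨q, τ q⟩ : TangentBundle 𝓘(ℝ, F) S))
    (hnn : ∀ q, g.pullback i q (n q) (n q) = -1)
    (hnτ : ∀ q, g.pullback i q (n q) (τ q) = 0)
    {ε : ℝ} (hε : ε * ε = 1) (p : S) {v : ℝ} (hv : v ∈ Set.Ioo (-1 : ℝ) 1) (hv0 : v ≠ 0) :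
    g.aCen i n τ p v = -(ε * v) • g.aCor i n τ p v ↔
      ∃ r : ℝ, g.nablaOn i (n + ε • τ) (n + ε • τ) p = r • pushField (E := E) i (n + ε • τ) p := by
  have hdn := mdifferentiableAt_coordAlong_pushField hk hi hn p
  have hdτ := mdifferentiableAt_coordAlong_pushField hk hi hτ p
  have hdετ : MDifferentiableAt 𝓘(ℝ, F) 𝓘(ℝ, E)
      (coordAlong i (ε • pushField (E := E) i τ) (i p)) p := by
    rw [coordAlong_smul]
    exact hdτ.const_smul ε
  have hnabla : g.nablaOn i (n + ε • τ) (n + ε • τ) p =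
      g.nablaOn i n n p + ε • g.nablaOn i τ n p +
        ε • (g.nablaOn i n τ p + ε • g.nablaOn i τ τ p) := by
    simp only [nablaOn, pushField_add, pushField_smul, Pi.add_apply, Pi.smul_apply,
      nabla_add_direction, nabla_smul_direction, g.nabla_add hdn hdετ, g.nabla_smul ε hdτ]
  have hpush : pushField (E := E) i (n + ε • τ) p = pushField i n p + ε • pushField i τ p := by
    rw [pushField_add, pushField_smul]
    rfl
  have hnn' := g.val_nablaOn_add_val_nablaOn hk hi hn hn hnn
  have hnτ' := g.val_nablaOn_add_val_nablaOn hk hi hn hτ hnτ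
  have hγ : lorentzFactor v ^ 2 * v ^ 2 ≠ 0 :=
    mul_ne_zero (left_ne_zero_of_mul_eq_one (lorentzFactor_sq hv)) (pow_ne_zero 2 hv0)
  rw [hnabla, hpush]
  exact (neg_smul_eq_neg_smul_smul_iff hγ).trans (add_smul_eq_zero_iff_exists_smul
    (ContinuousLinearMap.coeLM ℝ ∘ₗ (g.val (i p)).toLinearMap) hε (hnn p)
    (((g.lorentz _).1 _ _).trans (hnτ p))
    -- For `X = Y = n` both summands coincide, so each `g(∇_Z n, n)` equals its own negative and
    -- vanishes.
    (self_eq_neg.1 (eq_neg_of_add_eq_zero_left (hnn' n p)))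
    (self_eq_neg.1 (eq_neg_of_add_eq_zero_left (hnn' τ p)))
    (eq_neg_of_add_eq_zero_left (hnτ' n p)) (eq_neg_of_add_eq_zero_left (hnτ' τ p)))

/-- A worldline enters the equation only through its position and the value of `v` there, so a
single nonzero `v` at `p` already decides the matter. -/
theorem forall_isWorldline_iff [CompleteSpace F] (hk : 1 ≤ k)
    (hi : ContMDiff 𝓘(ℝ, F) 𝓘(ℝ, E) (k + 1) i)
    (hn : ContMDiff 𝓘(ℝ, F) 𝓘(ℝ, F).tangent k fun q => (⟨q, n q⟩ : TangentBundle 𝓘(ℝ, F) S))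
    (hτ : ContMDiff 𝓘(ℝ, F) 𝓘(ℝ, F).tangent k fun q => (⟨q, τ q⟩ : TangentBundle 𝓘(ℝ, F) S))
    (hnn : ∀ q, g.pullback i q (n q) (n q) = -1)
    (hnτ : ∀ q, g.pullback i q (n q) (τ q) = 0)
    (hττ : ∀ q, g.pullback i q (τ q) (τ q) = 1) {ε : ℝ} (hε : ε * ε = 1) (p : S) :
    (∀ (c : ℝ → S) (J : Set ℝ) (v : ℝ → ℝ), g.IsWorldline (F := F) i c J →
        IsSpatialVelocity n τ c J v → ∀ t ∈ J, c t = p →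
          g.aCen i n τ (c t) (v t) = -(ε * v t) • g.aCor i n τ (c t) (v t)) ↔
      ∃ r : ℝ, g.nablaOn i (n + ε • τ) (n + ε • τ) p = r • pushField (E := E) i (n + ε • τ) p := by
  constructor
  · intro h
    -- Any nonzero speed below `1` would serve.
    have hv : (1 / 2 : ℝ) ∈ Set.Ioo (-1 : ℝ) 1 := by norm_num
    obtain ⟨c, J, hw, hs, h0, rfl⟩ := g.exists_isWorldline hk hn hτ hnn hnτ hττ p hv
    exact (g.aCen_eq_neg_smul_aCor_iff hk hi hn hτ hnn hnτ hε (c 0) hv (by norm_num)).1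
      (h c J _ hw hs 0 h0 rfl)
  · rintro h c J v - hs t ht rfl
    by_cases hv0 : v t = 0
    -- At `v = 0` both accelerations vanish.
    · simp [hv0, aCen, aCor]
    · exact (g.aCen_eq_neg_smul_aCor_iff hk hi hn hτ hnn hnτ hε (c t) (hs t ht).1 hv0).2 h

theorem forall_isWorldline_iff_integralCurvesAreGeodesics [CompleteSpace F] (hk : 1 ≤ k)
    (hi : ContMDiff 𝓘(ℝ, F) 𝓘(ℝ, E) (k + 1) i)
    (hn : ContMDiff 𝓘(ℝ, F) 𝓘(ℝ, F).tangent k fun q => (⟨q, n q⟩ : TangentBundle 𝓘(ℝ, F) S))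
    (hτ : ContMDiff 𝓘(ℝ, F) 𝓘(ℝ, F).tangent k fun q => (⟨q, τ q⟩ : TangentBundle 𝓘(ℝ, F) S))
    (hnn : ∀ q, g.pullback i q (n q) (n q) = -1)
    (hnτ : ∀ q, g.pullback i q (n q) (τ q) = 0)
    (hττ : ∀ q, g.pullback i q (τ q) (τ q) = 1) {ε : ℝ} (hε : ε * ε = 1) :
    (∀ (c : ℝ → S) (J : Set ℝ) (v : ℝ → ℝ), g.IsWorldline (F := F) i c J →
        IsSpatialVelocity n τ c J v → ∀ t ∈ J,
          g.aCen i n τ (c t) (v t) = -(ε * v t) • g.aCor i n τ (c t) (v t)) ↔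
      g.IntegralCurvesAreGeodesics i (n + ε • τ) := by
  have hl0 (q : S) : pushField (E := E) i (n + ε • τ) q ≠ 0 := by
    intro h
    -- A vanishing `l` would contradict `g(n, n + ε τ) = -1`.
    have h1 : g.pullback i q (n q) ((n + ε • τ) q) = 0 :=
      (congrArg (g.val (i q) (pushField i n q)) h).trans (map_zero _)
    simp only [Pi.add_apply, Pi.smul_apply, map_add, map_smul, hnn, hnτ] at h1
    norm_num at h1
  rw [g.integralCurvesAreGeodesics_iff hk hi (hn.add_section hτ.const_smul_section) hl0]
  simp only [← g.forall_isWorldline_iff hk hi hn hτ hnn hnτ hττ hε]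
  exact ⟨fun h _ c J v hw hs t ht _ => h c J v hw hs t ht,
    fun h c J v hw hs t ht => h _ c J v hw hs t ht rfl⟩

end LorentzMetric

/-! ### The main theorem: the cases `ε = 1` and `ε = -1`. -/

theorem proposition1
    {E : Type*} [NormedAddCommGroup E] [NormedSpace ℝ E] [FiniteDimensional ℝ E]
    {F : Type*} [NormedAddCommGroup F] [NormedSpace ℝ F] [FiniteDimensional ℝ F]
    (hF : Module.finrank ℝ F = 2)
    (k : ℕ∞) (hk : 1 ≤ k)
    {M : Type*} [TopologicalSpace M] [ChartedSpace E M]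
    [IsManifold 𝓘(ℝ, E) 1 M] [IsManifold 𝓘(ℝ, E) (k + 1) M]
    {S : Type*} [TopologicalSpace S] [ChartedSpace F S]
    [IsManifold 𝓘(ℝ, F) 1 S] [IsManifold 𝓘(ℝ, F) (k + 1) S]
    (g : LorentzMetric E M k) (i : S → M) (hi : g.IsTimelikeSubmanifold (F := F) i)
    (n τ : ∀ q : S, TangentSpace 𝓘(ℝ, F) q)
    (hn : ContMDiff 𝓘(ℝ, F) 𝓘(ℝ, F).tangent k fun q => (⟨q, n q⟩ : TangentBundle 𝓘(ℝ, F) S))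
    (hτ : ContMDiff 𝓘(ℝ, F) 𝓘(ℝ, F).tangent k fun q => (⟨q, τ q⟩ : TangentBundle 𝓘(ℝ, F) S))
    (hnn : ∀ q, g.pullback i q (n q) (n q) = -1)
    (hnτ : ∀ q, g.pullback i q (n q) (τ q) = 0)
    (hττ : ∀ q, g.pullback i q (τ q) (τ q) = 1) :
    -- the upper sign
    ((∀ (c : ℝ → S) (J : Set ℝ) (v : ℝ → ℝ), g.IsWorldline (F := F) i c J →
        IsSpatialVelocity n τ c J v →
          ∀ t ∈ J, g.aCen i n τ (c t) (v t) = -(v t) • g.aCor i n τ (c t) (v t)) ↔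
      g.IntegralCurvesAreGeodesics i (n + τ)) ∧
    -- the lower sign
    ((∀ (c : ℝ → S) (J : Set ℝ) (v : ℝ → ℝ), g.IsWorldline (F := F) i c J →
        IsSpatialVelocity n τ c J v →
          ∀ t ∈ J, g.aCen i n τ (c t) (v t) = v t • g.aCor i n τ (c t) (v t)) ↔
      g.IntegralCurvesAreGeodesics i (n - τ)) ∧
    -- the pointwise versions, at an arbitrary point `p`
    ∀ p : S,
      ((∀ (c : ℝ → S) (J : Set ℝ) (v : ℝ → ℝ), g.IsWorldline (F := F) i c J →
          IsSpatialVelocity n τ c J v →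
            ∀ t ∈ J, c t = p →
              g.aCen i n τ (c t) (v t) = -(v t) • g.aCor i n τ (c t) (v t)) ↔
        ∃ r : ℝ, g.nablaOn i (n + τ) (n + τ) p = r • pushField (E := E) i (n + τ) p) ∧
      ((∀ (c : ℝ → S) (J : Set ℝ) (v : ℝ → ℝ), g.IsWorldline (F := F) i c J →
          IsSpatialVelocity n τ c J v →
            ∀ t ∈ J, c t = p →
              g.aCen i n τ (c t) (v t) = v t • g.aCor i n τ (c t) (v t)) ↔
        ∃ r : ℝ, g.nablaOn i (n - τ) (n - τ) p = r • pushField (E := E) i (n - τ) p) := by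
  have : CompleteSpace F := FiniteDimensional.complete ℝ F
  have hi' := hi.immersion.contMDiff
  have hplus : n + (1 : ℝ) • τ = n + τ := by rw [one_smul]
  have hminus : n + (-1 : ℝ) • τ = n - τ := by rw [neg_one_smul, sub_eq_add_neg]
  have glob {ε : ℝ} (hε : ε * ε = 1) :=
    g.forall_isWorldline_iff_integralCurvesAreGeodesics hk hi' hn hτ hnn hnτ hττ hε
  have pw {ε : ℝ} (hε : ε * ε = 1) :=
    g.forall_isWorldline_iff hk hi' hn hτ hnn hnτ hττ hε
  have glob_plus := glob (ε := 1) (by norm_num)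
  have glob_minus := glob (ε := -1) (by norm_num)
  have pw_plus := pw (ε := 1) (by norm_num)
  have pw_minus := pw (ε := -1) (by norm_num)
  simp only [hplus, one_mul] at glob_plus pw_plus
  simp only [hminus, neg_one_mul, neg_neg] at glob_minus pw_minus
  exact ⟨glob_plus, glob_minus, fun p => ⟨pw_plus p, pw_minus p⟩⟩
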